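/- Let $X, Y$ be real Banach spaces and let $\mu_0$ be a convex (log-concave) Radon probability measure on $X$: a Borel probability measure, inner regular with respect to compact sets, with $\mu_0(\lambda A+(1-\lambda)B)\ge \mu_0(A)^{\lambda}\mu_0(B)^{1-\lambda}$ for all $0\le\lambda\le 1$ and all nonempty Borel sets $A,B\subseteq X$. Let $\alpha_1,\alpha_2\ge 0$ and let $\Phi:X\times Y\to\mathbb{R}$ satisfy, for every $r>0$: 1. there is $M\in\mathbb{R}$ with $\Phi(u;y)\ge M-\alpha_1\|u\|_X$ for all $u\in X$ and all $y$ with $\|y\|_Y<r$; 2. there is $K>0$ with $\Phi(u;y)\le K$ whenever $\max\{\|u\|_X,\|y\|_Y\}<r$; 3. there is $L>0$ with $|\Phi(u_1;y)-\Phi(u_2;y)|\le L\|u_1-u_2\|_X$ whenever $\max\{\|u_1\|_X,\|u_2\|_X,\|y\|_Y\}<r$; 4. there is $C\in\mathbb{R}$ with $|\Phi(u;y_1)-\Phi(u;y_2)|\le \exp(\alpha_2\|u\|_X+C)\,\|y_1-y_2\|_Y$ for all $u\in X$ whenever $\max\{\|y_1\|_Y,\|y_2\|_Y\}<r$. For $y\in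 Y$, the posterior $\mu^y$ is a Borel probability measure $\mu^y\ll\mu_0$ with $$\frac{d\mu^y}{d\mu_0}(u)=\frac{1}{Z(y)}\exp(-\Phi(u;y)),\qquad Z(y)=\int_X\exp(-\Phi(u;y))\,d\mu_0(u)\in(0,\infty).$$ Let $d_H(\mu_1,\mu_2)=\Big(\tfrac12\int_X\big(\sqrt{d\mu_1/d\Lambda}-\sqrt{d\mu_2/d\Lambda}\big)^2d\Lambda\Big)^{1/2}$ be the Hellinger distance, where $\Lambda$ is any $\sigma$-finite measure dominating $\mu_1$ and $\mu_2$. Then there is a $\kappa>0$ with $\int_X\exp(\kappa\|u\|_X)\,d\mu_0(u)<\infty$. Moreover, for every such $\kappa$ with $\kappa\ge\alpha_1+2\alpha_2$: (i) The inverse problem is Hellinger well-posed: for every $y\in Y$ there is exactly one posterior $\mu^y$; and for all $r,\epsilon>0$ there is $C>0$ such that $d_H(\mu^y,\mu^{y'})<\epsilon$ whenever $\|y\|_Y,\|y'\|_Y<r$ and $\|y-y'\|_Y<C$. (ii) Fix $y\in Y$ and $\alpha_3\ge 0$ with $\kappa\ge\alpha_1+2\alpha_3$. Let $\Phi_N:X\times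 Y\to\mathbb{R}$, $N\in\mathbb{N}$, be such that $\Phi_N(\cdot;y)$ is $\mu_0$-measurable for every $N$, the $\Phi_N$ satisfy conditions 1 (with the same $\alpha_1$) and 2 with constants $M,K$ independent of $N$, and for some $C\in\mathbb{R}$ and some $\psi(N)\to 0$ one has $|\Phi(u;y)-\Phi_N(u;y)|\le\exp(\alpha_3\|u\|_X+C)\,\psi(N)$ for all $u\in X$ and $N\in\mathbb{N}$. Then the posterior $\mu^y$ and the posteriors $\mu^y_N$ defined with $\Phi_N$ in place of $\Phi$ exist and are unique, and $d_H(\mu^y,\mu^y_N)\to 0$ as $N\to\infty$. (iii) If, for some $y\in Y$, the function $\Phi(\cdot;y)$ is convex on $X$, then $\mu^y$ is again a convex Radon probability measure. -/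

import Mathlib

open MeasureTheory Filter Topology Set
open scoped Pointwise ENNReal

noncomputable section

namespace BayesInverse

/-- A convex (log-concave) Radon probability measure on the Borel sets of `X`. `InnerRegular` is
inner approximation of every Borel set by compact sets. The sets `A`, `B` are nonempty because for
`l = 0` and `A = ∅` the inequality would read `0 ≥ μ B`; for `0 < l < 1` the case of an empty set is
trivial. The set `l • A + (1 - l) • B` need not be Borel and is measured by the outer measure of
`μ`; by inner regularity, this is the same as measuring it by the completion of `μ`. -/
structure IsConvexProbabilityMeasure {X : Type*} [NormedAddCommGroup X] [NormedSpace ℝ X]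
    [MeasurableSpace X] (μ : Measure X) : Prop where
  isProbability : IsProbabilityMeasure μ
  isInnerRegular : μ.InnerRegular
  convex_ineq : ∀ l : ℝ, 0 ≤ l → l ≤ 1 → ∀ A B : Set X, MeasurableSet A → MeasurableSet B →
    A.Nonempty → B.Nonempty → μ A ^ l * μ B ^ (1 - l) ≤ μ (l • A + (1 - l) • B)

/-- `∫ exp (κ ‖u‖) dμ(u) < ∞`. -/
def HasExpMoment {X : Type*} [NormedAddCommGroup X] [MeasurableSpace X]
    (μ : Measure X) (κ : ℝ) : Prop :=
  Integrable (fun u => Real.exp (κ * ‖u‖)) μ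

/-- The assumptions on the likelihood potential `Φ(u; y)`, with constants `α₁`, `α₂`. -/
structure LikelihoodAssumption {X Y : Type*} [NormedAddCommGroup X] [NormedAddCommGroup Y]
    (Φ : X → Y → ℝ) (α₁ α₂ : ℝ) : Prop where
  lower_bound : ∀ r : ℝ, 0 < r → ∃ M : ℝ, ∀ u : X, ∀ y : Y, ‖y‖ < r → M - α₁ * ‖u‖ ≤ Φ u y
  bounded_above : ∀ r : ℝ, 0 < r → ∃ K : ℝ, 0 < K ∧
    ∀ u : X, ∀ y : Y, max ‖u‖ ‖y‖ < r → Φ u y ≤ K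
  continuity_u : ∀ r : ℝ, 0 < r → ∃ L : ℝ, 0 < L ∧ ∀ u₁ u₂ : X, ∀ y : Y,
    max (max ‖u₁‖ ‖u₂‖) ‖y‖ < r → |Φ u₁ y - Φ u₂ y| ≤ L * ‖u₁ - u₂‖
  continuity_y : ∀ r : ℝ, 0 < r → ∃ C : ℝ, ∀ y₁ y₂ : Y, max ‖y₁‖ ‖y₂‖ < r → ∀ u : X,
    |Φ u y₁ - Φ u y₂| ≤ Real.exp (α₂ * ‖u‖ + C) * ‖y₁ - y₂‖

/-- The assumptions on approximations `Φ_N` of `Φ` at the data `y`: measurability (so that the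
approximate Bayes rule makes sense), the lower and upper bounds uniformly in `N`, and the
approximation bound with constant `α₃` and some rate `ψ(N) → 0`. -/
structure ApproximationAssumption {X Y : Type*} [NormedAddCommGroup X] [NormedAddCommGroup Y]
    [MeasurableSpace X] (μ₀ : Measure X) (Φ : X → Y → ℝ) (ΦN : ℕ → X → Y → ℝ) (y : Y)
    (α₁ α₃ : ℝ) : Prop where
  aemeasurable : ∀ N : ℕ, AEMeasurable (fun u => ΦN N u y) μ₀
  lower_bound : ∀ r : ℝ, 0 < r → ∃ M : ℝ, ∀ N : ℕ, ∀ u : X, ∀ y : Y, ‖y‖ < r →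
    M - α₁ * ‖u‖ ≤ ΦN N u y
  bounded_above : ∀ r : ℝ, 0 < r → ∃ K : ℝ, 0 < K ∧ ∀ N : ℕ, ∀ u : X, ∀ y : Y,
    max ‖u‖ ‖y‖ < r → ΦN N u y ≤ K
  approx : ∃ C : ℝ, ∃ ψ : ℕ → ℝ, Tendsto ψ atTop (𝓝 0) ∧
    ∀ N : ℕ, ∀ u : X, |Φ u y - ΦN N u y| ≤ Real.exp (α₃ * ‖u‖ + C) * ψ N

/-- The normalizing constant `Z(y) = ∫ exp (-Φ(u; y)) dμ₀(u)`. -/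
def normalizer {X Y : Type*} [MeasurableSpace X] (μ₀ : Measure X) (Φ : X → Y → ℝ) (y : Y) : ℝ :=
  ∫ u, Real.exp (-Φ u y) ∂μ₀

/-- `ν` is a posterior probability measure given by Bayes' rule: `ν ≪ μ₀` and
`dν/dμ₀ (u) = Z(y)⁻¹ exp (-Φ(u; y))`, with `0 < Z(y) < ∞`. -/
structure IsPosterior {X Y : Type*} [MeasurableSpace X] (μ₀ : Measure X) (Φ : X → Y → ℝ) (y : Y)
    (ν : Measure X) : Prop where
  isProbability : IsProbabilityMeasure ν
  absolutelyContinuous : ν ≪ μ₀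
  integrable : Integrable (fun u => Real.exp (-Φ u y)) μ₀
  normalizer_pos : 0 < normalizer μ₀ Φ y
  bayes_rule : ν.rnDeriv μ₀ =ᵐ[μ₀]
    fun u => ENNReal.ofReal ((normalizer μ₀ Φ y)⁻¹ * Real.exp (-Φ u y))

/-- The Hellinger distance of two finite measures, computed with the dominating measure
`Λ = μ₁ + μ₂` (its value does not depend on the choice of the dominating measure). -/
def hellingerDist {X : Type*} [MeasurableSpace X] (μ₁ μ₂ : Measure X) : ℝ :=
  Real.sqrt ((1 / 2) * ∫ u, (Real.sqrt (μ₁.rnDeriv (μ₁ + μ₂) u).toReal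
    - Real.sqrt (μ₂.rnDeriv (μ₁ + μ₂) u).toReal) ^ 2 ∂(μ₁ + μ₂))

/-- Hellinger well-posedness: for every `y` there is exactly one posterior, and the posterior
depends continuously on `y` in the Hellinger distance, uniformly on bounded sets of data. -/
structure IsWellPosed {X Y : Type*} [NormedAddCommGroup Y] [MeasurableSpace X]
    (μ₀ : Measure X) (Φ : X → Y → ℝ) : Prop where
  existsUnique : ∀ y : Y, ∃! ν : Measure X, IsPosterior μ₀ Φ y ν
  stable : ∀ r : ℝ, 0 < r → ∀ ε : ℝ, 0 < ε → ∃ C : ℝ, 0 < C ∧ ∀ y y' : Y,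
    ‖y‖ < r → ‖y'‖ < r → ‖y - y'‖ < C → ∀ ν ν' : Measure X,
      IsPosterior μ₀ Φ y ν → IsPosterior μ₀ Φ y' ν' → hellingerDist ν ν' < ε

/-- Consistency of the approximate posteriors at the data `y`: the posterior and all the
approximate posteriors exist and are unique, and the latter converge to the former in the
Hellinger distance. -/
structure IsConsistentApproximation {X Y : Type*} [MeasurableSpace X]
    (μ₀ : Measure X) (Φ : X → Y → ℝ) (ΦN : ℕ → X → Y → ℝ) (y : Y) : Prop where
  existsUnique : ∃! ν : Measure X, IsPosterior μ₀ Φ y ν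
  existsUnique_approx : ∀ N : ℕ, ∃! ν : Measure X, IsPosterior μ₀ (ΦN N) y ν
  tendsto : ∀ (ν : Measure X) (νN : ℕ → Measure X), IsPosterior μ₀ Φ y ν →
    (∀ N : ℕ, IsPosterior μ₀ (ΦN N) y (νN N)) →
    Tendsto (fun N => hellingerDist ν (νN N)) atTop (𝓝 0)

end BayesInverse

end

/-!
Exponential moments come from Borell's lemma: for a symmetric convex set `A` and `t ≥ 1`, the set
`A` is disjoint from `2 / (t + 1) • (t • A)ᶜ + (1 - 2 / (t + 1)) • A`, so log-concavity makes
`μ (t • A)ᶜ` decay exponentially in `t` as soon as `μ A > 1 / 2`.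

The squared Hellinger distance is at most the total variation distance, and normalizing a density
costs at most a factor two in `L¹`. Hence both stability statements reduce to bounding
`∫ |exp (-Φ) - exp (-Φ')| dμ₀` by a multiple of `∫ exp ((α₁ + α) ‖u‖) dμ₀`, where `α` is the growth
rate in the bound for `|Φ - Φ'|`. Going through the total variation is what gives `α₁ + α` in place
of the `α₁ + 2 * α` that results from bounding the squared difference of the root densities.

For the convexity of the posterior, `∫_S exp (-φ) dμ = ∫ exp (-t) μ ({φ ≤ t} ∩ S) dt`. If `φ` is
convex then `a • ({φ ≤ s} ∩ A) + b • ({φ ≤ t} ∩ B) ⊆ {φ ≤ a s + b t} ∩ (a • A + b • B)`, so that the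
log-concavity of `μ` is the hypothesis of the one-dimensional Prékopa–Leindler inequality in `t`.
-/

namespace BayesInverse

section PrekopaLeindler

/-- The translates `min L + K` and `max K + L` both lie in `K + L` and share only the point
`max K + min L`. -/
theorem volume_add_volume_le_of_isCompact {K L : Set ℝ} (hK : IsCompact K) (hL : IsCompact L)
    (hK₀ : K.Nonempty) (hL₀ : L.Nonempty) : volume K + volume L ≤ volume (K + L) := by
  obtain ⟨k, hkK, hk⟩ := hK.exists_isGreatest hK₀
  obtain ⟨l, hlL, hl⟩ := hL.exists_isLeast hL₀
  have volume_K : volume ((l + ·) '' K) = volume K := by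
    rw [image_add_left, measure_preimage_add]
  have volume_L : volume ((k + ·) '' L \ {k + l}) = volume L := by
    rw [measure_sdiff_null (measure_singleton _), image_add_left, measure_preimage_add]
  have disjoint : Disjoint ((l + ·) '' K) ((k + ·) '' L \ {k + l}) := by
    rw [disjoint_left]
    rintro _ ⟨x, hx, rfl⟩ ⟨⟨z, hz, hzx : k + z = l + x⟩, hne⟩
    exact hne (by rw [mem_singleton_iff]; linarith [hk hx, hl hz])
  have measurable_L : MeasurableSet ((k + ·) '' L \ {k + l}) :=
    (hL.image (by fun_prop)).measurableSet.diff (measurableSet_singleton _)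
  rw [← volume_K, ← volume_L, ← measure_union disjoint measurable_L]
  refine measure_mono ?_
  rintro _ (⟨x, hx, rfl⟩ | ⟨⟨x, hx, rfl⟩, -⟩)
  · exact ⟨x, hx, l, hlL, add_comm _ _⟩
  · exact ⟨k, hkK, x, hx, rfl⟩

theorem volume_add_volume_le {A B : Set ℝ} (hA : MeasurableSet A) (hB : MeasurableSet B)
    (hA₀ : A.Nonempty) (hB₀ : B.Nonempty) : volume A + volume B ≤ volume (A + B) := by
  obtain ⟨x, hx⟩ := hA₀
  obtain ⟨z, hz⟩ := hB₀
  rw [hA.measure_eq_iSup_isCompact, hB.measure_eq_iSup_isCompact]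
  simp only [iSup_and']
  refine ENNReal.biSup_add_biSup_le' ⟨∅, empty_subset _, isCompact_empty⟩
    ⟨∅, empty_subset _, isCompact_empty⟩ ?_
  rintro K ⟨hKA, hK⟩ L ⟨hLB, hL⟩
  calc volume K + volume L
      ≤ volume (insert x K) + volume (insert z L) := by gcongr <;> exact subset_insert _ _
    _ ≤ volume (insert x K + insert z L) :=
        volume_add_volume_le_of_isCompact (hK.insert x) (hL.insert z)
          (insert_nonempty _ _) (insert_nonempty _ _)
    _ ≤ volume (A + B) :=
        measure_mono (add_subset_add (insert_subset hx hKA) (insert_subset hz hLB))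

theorem lintegral_eq_lintegral_measure_ofReal_lt {Ω : Type*} [MeasurableSpace Ω] (μ : Measure Ω)
    [SFinite μ] {f : Ω → ℝ≥0∞} (hf : Measurable f) :
    ∫⁻ x, f x ∂μ = ∫⁻ t in Ioi (0 : ℝ), μ {x | ENNReal.ofReal t < f x} := by
  have volume_section (c : ℝ≥0∞) :
      volume.restrict (Ioi 0) {t : ℝ | ENNReal.ofReal t < c} = c := by
    rw [Measure.restrict_apply' measurableSet_Ioi]
    induction c with
    | top => simp
    | coe r =>
      have : {t : ℝ | ENNReal.ofReal t < r} ∩ Ioi 0 = Ioo 0 (r : ℝ) := by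
        ext t
        rw [mem_Ioo, and_comm]
        refine and_congr_left fun ht : 0 < t => ?_
        rw [mem_ofPred_eq, ← ENNReal.ofReal_coe_nnreal,
          ENNReal.ofReal_lt_ofReal_iff_of_nonneg ht.le]
      rw [this, Real.volume_Ioo, sub_zero, ENNReal.ofReal_coe_nnreal]
  have hypograph : MeasurableSet {p : Ω × ℝ | ENNReal.ofReal p.2 < f p.1} :=
    measurableSet_lt (by fun_prop) (by fun_prop)
  calc ∫⁻ x, f x ∂μ
      = ∫⁻ x, volume.restrict (Ioi 0) {t : ℝ | ENNReal.ofReal t < f x} ∂μ := by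
        simp_rw [volume_section]
    _ = μ.prod (volume.restrict (Ioi 0)) {p : Ω × ℝ | ENNReal.ofReal p.2 < f p.1} :=
        (Measure.prod_apply hypograph).symm
    _ = ∫⁻ t in Ioi (0 : ℝ), μ {x | ENNReal.ofReal t < f x} := Measure.prod_apply_symm hypograph

variable {a b : ℝ} {f g h : ℝ → ℝ≥0∞}

theorem rpow_mul_rpow_le_ofReal_mul_add_ofReal_mul (ha : 0 < a) (hb : 0 < b) (hab : a + b = 1)
    (x y : ℝ≥0∞) :
    x ^ a * y ^ b ≤ ENNReal.ofReal a * x + ENNReal.ofReal b * y := by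
  have young := ENNReal.young_inequality (x ^ a) (y ^ b) (Real.HolderConjugate.inv_inv ha hb hab)
  simpa only [← ENNReal.rpow_mul, mul_inv_cancel₀ ha.ne', mul_inv_cancel₀ hb.ne', ENNReal.rpow_one,
    div_eq_mul_inv, ENNReal.ofReal_inv_of_pos ha, ENNReal.ofReal_inv_of_pos hb, inv_inv,
    mul_comm x, mul_comm y] using young

theorem mul_volume_superlevel_add_le (hf : Measurable f) (hg : Measurable g) (ha : 0 < a)
    (hb : 0 < b) (hab : a + b = 1) (H : ∀ s t, f s ^ a * g t ^ b ≤ h (a * s + b * t)) {c : ℝ≥0∞}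
    (hcf : c < ⨆ x, f x) (hcg : c < ⨆ x, g x) :
    ENNReal.ofReal a * volume {x | c < f x} + ENNReal.ofReal b * volume {x | c < g x} ≤
      volume {x | c < h x} := by
  have volume_smul {r : ℝ} (hr : 0 < r) (S : Set ℝ) :
      volume (r • S) = ENNReal.ofReal r * volume S := by
    simpa using Measure.addHaar_smul_of_nonneg volume hr.le S
  have hA : MeasurableSet {x | c < f x} := measurableSet_lt measurable_const hf
  have hB : MeasurableSet {x | c < g x} := measurableSet_lt measurable_const hg
  rw [← volume_smul ha, ← volume_smul hb]
  refine (volume_add_volume_le (hA.const_smul₀ a) (hB.const_smul₀ b)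
    (Set.Nonempty.smul_set (lt_iSup_iff.1 hcf))
    (Set.Nonempty.smul_set (lt_iSup_iff.1 hcg))).trans (measure_mono ?_)
  rintro _ ⟨_, ⟨s, hs : c < f s, rfl⟩, _, ⟨t, ht : c < g t, rfl⟩, rfl⟩
  calc c = c ^ a * c ^ b := by
        rw [← ENNReal.rpow_add_of_nonneg _ _ ha.le hb.le, hab, ENNReal.rpow_one]
    _ < f s ^ a * g t ^ b :=
        ENNReal.mul_lt_mul (ENNReal.rpow_lt_rpow hs ha) (ENNReal.rpow_lt_rpow ht hb)
    _ ≤ h (a * s + b * t) := H s t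

theorem mul_lintegral_add_le_of_iSup_eq_one (hf : Measurable f) (hg : Measurable g)
    (hh : Measurable h) (hf₁ : ⨆ x, f x = 1) (hg₁ : ⨆ x, g x = 1) (ha : 0 < a) (hb : 0 < b)
    (hab : a + b = 1) (H : ∀ s t, f s ^ a * g t ^ b ≤ h (a * s + b * t)) :
    (ENNReal.ofReal a * ∫⁻ x, f x) + (ENNReal.ofReal b * ∫⁻ x, g x) ≤ ∫⁻ x, h x := by
  simp only [lintegral_eq_lintegral_measure_ofReal_lt volume hf,
    lintegral_eq_lintegral_measure_ofReal_lt volume hg,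
    lintegral_eq_lintegral_measure_ofReal_lt volume hh]
  rw [← lintegral_const_mul' _ _ ENNReal.ofReal_ne_top,
    ← lintegral_const_mul' _ _ ENNReal.ofReal_ne_top]
  refine (le_lintegral_add _ _).trans (lintegral_mono fun t => ?_)
  rcases lt_or_ge (ENNReal.ofReal t) 1 with ht | ht
  · exact mul_volume_superlevel_add_le hf hg ha hb hab H (hf₁ ▸ ht) (hg₁ ▸ ht)
  · have superlevel_eq_empty {k : ℝ → ℝ≥0∞} (hk : ⨆ x, k x = 1) :
        {x | ENNReal.ofReal t < k x} = ∅ :=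
      eq_empty_of_forall_notMem fun x hx => hx.not_ge ((hk ▸ le_iSup k x).trans ht)
    simp [superlevel_eq_empty hf₁, superlevel_eq_empty hg₁]

theorem prekopa_leindler_of_bounded (hf : Measurable f) (hg : Measurable g) (hh : Measurable h)
    (hf_top : ⨆ x, f x ≠ ∞) (hg_top : ⨆ x, g x ≠ ∞) (ha : 0 < a) (hb : 0 < b) (hab : a + b = 1)
    (H : ∀ s t, f s ^ a * g t ^ b ≤ h (a * s + b * t)) :
    (∫⁻ x, f x) ^ a * (∫⁻ x, g x) ^ b ≤ ∫⁻ x, h x := by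
  set α := ⨆ x, f x with hα
  set β := ⨆ x, g x with hβ
  rcases eq_or_ne α 0 with hα₀ | hα₀
  · simp [ENNReal.iSup_eq_zero.1 hα₀, ha]
  rcases eq_or_ne β 0 with hβ₀ | hβ₀
  · simp [ENNReal.iSup_eq_zero.1 hβ₀, hb]
  have hγ₀ : α ^ a * β ^ b ≠ 0 := by simp [hα₀, hβ₀, hf_top, hg_top]
  have hγ_top : α ^ a * β ^ b ≠ ∞ := by finiteness
  have mul_rpow_mul_rpow (c d x y : ℝ≥0∞) :
      (c * x) ^ a * (d * y) ^ b = c ^ a * d ^ b * (x ^ a * y ^ b) := by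
    rw [ENNReal.mul_rpow_of_nonneg _ _ ha.le, ENNReal.mul_rpow_of_nonneg _ _ hb.le,
      mul_mul_mul_comm]
  have inv_rpow_mul : (α⁻¹) ^ a * (β⁻¹) ^ b = (α ^ a * β ^ b)⁻¹ := by
    rw [ENNReal.inv_rpow, ENNReal.inv_rpow,
      ENNReal.mul_inv (.inr (by finiteness)) (.inl (by finiteness))]
  have normalized := mul_lintegral_add_le_of_iSup_eq_one (hf.const_mul α⁻¹) (hg.const_mul β⁻¹)
    (hh.const_mul (α ^ a * β ^ b)⁻¹)
    (by rw [← ENNReal.mul_iSup, ← hα, ENNReal.inv_mul_cancel hα₀ hf_top])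
    (by rw [← ENNReal.mul_iSup, ← hβ, ENNReal.inv_mul_cancel hβ₀ hg_top]) ha hb hab
    fun s t => by rw [mul_rpow_mul_rpow, inv_rpow_mul]; gcongr; exact H s t
  have amgm := (rpow_mul_rpow_le_ofReal_mul_add_ofReal_mul ha hb hab _ _).trans normalized
  rw [lintegral_const_mul _ hf, lintegral_const_mul _ hg, lintegral_const_mul _ hh,
    mul_rpow_mul_rpow, inv_rpow_mul] at amgm
  exact (ENNReal.mul_le_mul_iff_right (ENNReal.inv_ne_zero.2 hγ_top)
    (ENNReal.inv_ne_top.2 hγ₀)).1 amgm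

theorem rpow_lintegral_eq_iSup_min_natCast {Ω : Type*} [MeasurableSpace Ω] (μ : Measure Ω)
    {f : Ω → ℝ≥0∞} (hf : Measurable f) {p : ℝ} (hp : 0 < p) :
    (∫⁻ x, f x ∂μ) ^ p = ⨆ n : ℕ, (∫⁻ x, min (f x) n ∂μ) ^ p := by
  have iSup_min (c : ℝ≥0∞) : ⨆ n : ℕ, min c n = c := by
    rw [← inf_iSup_eq, ENNReal.iSup_natCast, inf_top_eq]
  calc (∫⁻ x, f x ∂μ) ^ p = (⨆ n : ℕ, ∫⁻ x, min (f x) n ∂μ) ^ p := by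
        rw [← lintegral_iSup (fun n => hf.min measurable_const)
          fun m n hmn x => min_le_min_left _ (by exact_mod_cast hmn)]
        simp_rw [iSup_min]
    _ = ⨆ n : ℕ, (∫⁻ x, min (f x) n ∂μ) ^ p := (ENNReal.orderIsoRpow p hp).map_iSup _

theorem prekopa_leindler (hf : Measurable f) (hg : Measurable g) (hh : Measurable h)
    (ha : 0 < a) (hb : 0 < b) (hab : a + b = 1)
    (H : ∀ s t, f s ^ a * g t ^ b ≤ h (a * s + b * t)) :
    (∫⁻ x, f x) ^ a * (∫⁻ x, g x) ^ b ≤ ∫⁻ x, h x := by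
  have iSup_min_ne_top (k : ℝ → ℝ≥0∞) (n : ℕ) : ⨆ x, min (k x) n ≠ ∞ :=
    ne_top_of_le_ne_top (ENNReal.natCast_ne_top n) (iSup_le fun _ => min_le_right _ _)
  simp only [rpow_lintegral_eq_iSup_min_natCast volume hf ha,
    rpow_lintegral_eq_iSup_min_natCast volume hg hb, ENNReal.iSup_mul, ENNReal.mul_iSup]
  refine iSup₂_le fun m n => prekopa_leindler_of_bounded (hf.min measurable_const)
    (hg.min measurable_const) hh (iSup_min_ne_top f _) (iSup_min_ne_top g _) ha hb hab
    fun s t => le_trans ?_ (H s t)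
  gcongr <;> exact min_le_left _ _

end PrekopaLeindler

section Density

theorem lintegral_exp_neg_eq_lintegral_sublevel {Ω : Type*} [MeasurableSpace Ω] (μ : Measure Ω)
    [SFinite μ] {φ : Ω → ℝ} (hφ : Measurable φ) :
    ∫⁻ u, ENNReal.ofReal (Real.exp (-φ u)) ∂μ =
      ∫⁻ t : ℝ, ENNReal.ofReal (Real.exp (-t)) * μ {u | φ u ≤ t} := by
  set ρ : Measure ℝ := volume.withDensity fun t => ENNReal.ofReal (Real.exp (-t)) with hρ
  have ρ_section (c : ℝ) : ρ {t | c ≤ t} = ENNReal.ofReal (Real.exp (-c)) := by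
    rw [hρ, withDensity_apply' _ _, ← integral_exp_neg_Ioi c,
      ofReal_integral_eq_lintegral_ofReal (integrableOn_exp_neg_Ioi c)
        (ae_of_all _ fun t => (Real.exp_pos _).le)]
    exact setLIntegral_congr Ioi_ae_eq_Ici.symm
  have epigraph : MeasurableSet {p : Ω × ℝ | φ p.1 ≤ p.2} :=
    measurableSet_le (by fun_prop) (by fun_prop)
  calc ∫⁻ u, ENNReal.ofReal (Real.exp (-φ u)) ∂μ = ∫⁻ u, ρ {t | φ u ≤ t} ∂μ := by
        simp_rw [ρ_section]
    _ = μ.prod ρ {p : Ω × ℝ | φ p.1 ≤ p.2} := (Measure.prod_apply epigraph).symm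
    _ = ∫⁻ t, μ {u | φ u ≤ t} ∂ρ := Measure.prod_apply_symm epigraph
    _ = ∫⁻ t : ℝ, ENNReal.ofReal (Real.exp (-t)) * μ {u | φ u ≤ t} :=
        lintegral_withDensity_eq_lintegral_mul _ (by fun_prop)
          (Monotone.measurable fun s t hst => measure_mono fun u hu => le_trans hu hst)

theorem innerRegular_of_absolutelyContinuous {X : Type*} [TopologicalSpace X] [T2Space X]
    [MeasurableSpace X] [OpensMeasurableSpace X] {μ ν : Measure X} [IsFiniteMeasure μ]
    [IsFiniteMeasure ν] [μ.InnerRegular] (h : ν ≪ μ) : ν.InnerRegular := by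
  refine ⟨fun U hU r hr => ?_⟩
  obtain ⟨δ, hδ, small⟩ := exists_pos_setLIntegral_lt_of_measure_lt (μ := μ) (f := ν.rnDeriv μ)
    (Measure.lintegral_rnDeriv_lt_top _ _).ne (tsub_pos_of_lt hr).ne'
  obtain ⟨K, hKU, hK, hKδ⟩ := hU.exists_isCompact_sdiff_lt (measure_ne_top μ U) hδ.ne'
  refine ⟨K, hKU, hK, ?_⟩
  have hlt : ν (U \ K) < ν U - r := Measure.setLIntegral_rnDeriv h (U \ K) ▸ small _ hKδ
  by_contra! hle
  refine lt_irrefl (ν U) ?_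
  calc ν U ≤ ν K + ν (U \ K) := by
        rw [← union_sdiff_cancel hKU]
        exact (measure_union_le _ _).trans_eq (by simp)
    _ ≤ r + ν (U \ K) := by gcongr
    _ < r + (ν U - r) := by gcongr; exact hr.ne_top
    _ = ν U := add_tsub_cancel_of_le hr.le

namespace IsConvexProbabilityMeasure

variable {X : Type*} [NormedAddCommGroup X] [NormedSpace ℝ X] [MeasurableSpace X]
  {μ : Measure X} {φ : X → ℝ} {A B : Set X} {a b : ℝ}

theorem rpow_mul_rpow_le (hμ : IsConvexProbabilityMeasure μ) (hA : MeasurableSet A)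
    (hB : MeasurableSet B) (ha : 0 < a) (hb : 0 < b) (hab : a + b = 1) :
    μ A ^ a * μ B ^ b ≤ μ (a • A + b • B) := by
  rcases A.eq_empty_or_nonempty with rfl | hA₀
  · simp [ha]
  rcases B.eq_empty_or_nonempty with rfl | hB₀
  · simp [hb]
  obtain rfl : b = 1 - a := by linarith
  exact hμ.convex_ineq a ha.le (by linarith) A B hA hB hA₀ hB₀

theorem rpow_setLIntegral_mul_rpow_setLIntegral_le (hμ : IsConvexProbabilityMeasure μ)
    (hφ : Measurable φ) (hφ_conv : ConvexOn ℝ univ φ) (hA : MeasurableSet A)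
    (hB : MeasurableSet B) (ha : 0 < a) (hb : 0 < b) (hab : a + b = 1) :
    (∫⁻ u in A, ENNReal.ofReal (Real.exp (-φ u)) ∂μ) ^ a *
        (∫⁻ u in B, ENNReal.ofReal (Real.exp (-φ u)) ∂μ) ^ b ≤
      ∫⁻ u in a • A + b • B, ENNReal.ofReal (Real.exp (-φ u)) ∂μ := by
  have := hμ.isProbability
  have sublevel (t : ℝ) : MeasurableSet {u | φ u ≤ t} := measurableSet_le hφ measurable_const
  have measurable_layer (S : Set X) :
      Measurable fun t => ENNReal.ofReal (Real.exp (-t)) * μ ({u | φ u ≤ t} ∩ S) :=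
    .mul (by fun_prop) (Monotone.measurable fun s t hst =>
      measure_mono (inter_subset_inter_left _ fun u hu => le_trans hu hst))
  have exp_neg_mul (s t : ℝ) : ENNReal.ofReal (Real.exp (-s)) ^ a *
      ENNReal.ofReal (Real.exp (-t)) ^ b = ENNReal.ofReal (Real.exp (-(a * s + b * t))) := by
    rw [ENNReal.ofReal_rpow_of_pos (Real.exp_pos _), ENNReal.ofReal_rpow_of_pos (Real.exp_pos _),
      ← ENNReal.ofReal_mul (by positivity), ← Real.exp_mul, ← Real.exp_mul, ← Real.exp_add]
    ring_nf
  have sublevel_add (s t : ℝ) : a • ({u | φ u ≤ s} ∩ A) + b • ({u | φ u ≤ t} ∩ B) ⊆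
      {u | φ u ≤ a * s + b * t} ∩ (a • A + b • B) := by
    rintro _ ⟨_, ⟨x, ⟨hx : φ x ≤ s, hxA⟩, rfl⟩, _, ⟨z, ⟨hz : φ z ≤ t, hzB⟩, rfl⟩, rfl⟩
    refine ⟨?_, add_mem_add (smul_mem_smul_set hxA) (smul_mem_smul_set hzB)⟩
    calc φ (a • x + b • z) ≤ a * φ x + b * φ z :=
          hφ_conv.2 (mem_univ x) (mem_univ z) ha.le hb.le hab
      _ ≤ a * s + b * t := by gcongr
  simp only [lintegral_exp_neg_eq_lintegral_sublevel _ hφ, Measure.restrict_apply (sublevel _)]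
  refine prekopa_leindler (measurable_layer A) (measurable_layer B) (measurable_layer _)
    ha hb hab fun s t => ?_
  rw [ENNReal.mul_rpow_of_nonneg _ _ ha.le, ENNReal.mul_rpow_of_nonneg _ _ hb.le,
    mul_mul_mul_comm, exp_neg_mul]
  gcongr
  exact (hμ.rpow_mul_rpow_le ((sublevel s).inter hA) ((sublevel t).inter hB) ha hb hab).trans
    (measure_mono (sublevel_add s t))

theorem withDensity_exp_neg [OpensMeasurableSpace X] (hμ : IsConvexProbabilityMeasure μ)
    (hφ : Measurable φ) (hφ_conv : ConvexOn ℝ univ φ)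
    (hν : IsProbabilityMeasure (μ.withDensity fun u => ENNReal.ofReal (Real.exp (-φ u)))) :
    IsConvexProbabilityMeasure (μ.withDensity fun u => ENNReal.ofReal (Real.exp (-φ u))) := by
  have := hμ.isProbability
  have := hμ.isInnerRegular
  refine ⟨hν, innerRegular_of_absolutelyContinuous (withDensity_absolutelyContinuous μ _),
    fun l hl₀ hl₁ A B hA hB hA₀ hB₀ => ?_⟩
  rcases hl₀.eq_or_lt with rfl | hl₀
  · simp [zero_smul_set hA₀]
  rcases hl₁.eq_or_lt with rfl | hl₁
  · simp [zero_smul_set hB₀]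
  simp only [withDensity_apply' _ _]
  exact hμ.rpow_setLIntegral_mul_rpow_setLIntegral_le hφ hφ_conv hA hB hl₀ (sub_pos.2 hl₁)
    (add_sub_cancel _ _)

end IsConvexProbabilityMeasure

end Density

section Borell

theorem smul_compl_smul_add_smul_subset_compl {E : Type*} [AddCommGroup E] [Module ℝ E]
    {A : Set E} (hA : Convex ℝ A) (hA_neg : ∀ x ∈ A, -x ∈ A) {t : ℝ} (ht : 1 ≤ t) :
    (2 / (t + 1)) • (t • A)ᶜ + (1 - 2 / (t + 1)) • A ⊆ Aᶜ := by
  rintro _ ⟨_, ⟨x, hx, rfl⟩, _, ⟨z, hz, rfl⟩, rfl⟩ hw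
  have ht₀ : 0 < t := by linarith
  have inv_smul_eq : t⁻¹ • x =
      ((t + 1) / (2 * t)) • ((2 / (t + 1)) • x + (1 - 2 / (t + 1)) • z) +
        ((t - 1) / (2 * t)) • -z := by
    match_scalars <;> field_simp
    ring
  refine hx ((mem_smul_set_iff_inv_smul_mem₀ ht₀.ne' _ _).2 ?_)
  rw [inv_smul_eq]
  exact hA hw (hA_neg z hz) (by positivity) (div_nonneg (by linarith) (by positivity))
    (by field_simp; ring)

theorem le_mul_div_rpow_inv_of_rpow_mul_rpow_le {x y z l : ℝ} (hx : 0 ≤ x) (hy : 0 < y)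
    (hl : 0 < l) (h : x ^ l * y ^ (1 - l) ≤ z) : x ≤ y * (z / y) ^ l⁻¹ := by
  have div_rpow_le : (x / y) ^ l ≤ z / y := by
    rw [Real.div_rpow hx hy.le, le_div_iff₀ hy]
    calc x ^ l / y ^ l * y = x ^ l * y ^ (1 - l) := by
          rw [Real.rpow_sub hy, Real.rpow_one]; ring
      _ ≤ z := h
  rw [← div_le_iff₀' hy]
  exact (Real.le_rpow_inv_iff_of_pos (by positivity)
    ((Real.rpow_nonneg (by positivity) _).trans div_rpow_le) hl).2 div_rpow_le

theorem exists_lt_measureReal_ball {X : Type*} [PseudoMetricSpace X] [MeasurableSpace X]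
    (μ : Measure X) [IsFiniteMeasure μ] (x : X) {c : ℝ} (hc : c < μ.real univ) :
    ∃ R : ℝ, 0 < R ∧ c < μ.real (Metric.ball x R) := by
  have balls_mono : Monotone fun n : ℕ => Metric.ball x n := fun m n hmn =>
    Metric.ball_subset_ball (by exact_mod_cast hmn)
  have tendsto_univ := tendsto_measure_iUnion_atTop (μ := μ) balls_mono
  rw [Metric.iUnion_ball_nat] at tendsto_univ
  obtain ⟨n, hn, hn₀⟩ := ((((ENNReal.tendsto_toReal (measure_ne_top μ univ)).comp
    tendsto_univ).eventually (lt_mem_nhds hc)).and (eventually_gt_atTop 0)).exists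
  exact ⟨n, by exact_mod_cast hn₀, hn⟩

theorem integrable_exp_mul_of_measure_natCast_le_le {Ω : Type*} [MeasurableSpace Ω]
    {μ : Measure Ω} {f : Ω → ℝ} (hf : AEMeasurable f μ) (hf₀ : ∀ x, 0 ≤ f x) {κ : ℝ} (hκ : 0 ≤ κ)
    {C q : ℝ≥0∞} (hC : C ≠ ∞) (hq : ENNReal.ofReal (Real.exp κ) * q < 1)
    (tail : ∀ n : ℕ, μ {x | n ≤ f x} ≤ C * q ^ n) :
    Integrable (fun x => Real.exp (κ * f x)) μ := by
  refine ⟨(hf.const_mul κ).exp.aestronglyMeasurable, ?_⟩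
  set e := ENNReal.ofReal (Real.exp κ) with he
  have pointwise (x : Ω) : ‖Real.exp (κ * f x)‖ₑ ≤
      ∑' n : ℕ, {x | n ≤ f x}.indicator (fun _ => e ^ (n + 1)) x := by
    refine le_trans ?_ (ENNReal.le_tsum ⌊f x⌋₊)
    have hx : x ∈ {z | (⌊f x⌋₊ : ℝ) ≤ f z} := Nat.floor_le (hf₀ x)
    rw [indicator_of_mem hx, Real.enorm_of_nonneg (Real.exp_pos _).le, he,
      ← ENNReal.ofReal_pow (Real.exp_pos _).le, ← Real.exp_nat_mul, mul_comm]
    gcongr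
    exact_mod_cast (Nat.lt_floor_add_one _).le
  calc ∫⁻ x, ‖Real.exp (κ * f x)‖ₑ ∂μ
      ≤ ∫⁻ x, ∑' n : ℕ, {x | n ≤ f x}.indicator (fun _ => e ^ (n + 1)) x ∂μ :=
        lintegral_mono pointwise
    _ = ∑' n : ℕ, ∫⁻ x, {x | n ≤ f x}.indicator (fun _ => e ^ (n + 1)) x ∂μ :=
        lintegral_tsum fun n =>
          aemeasurable_const.indicator₀ (nullMeasurableSet_le aemeasurable_const hf)
    _ ≤ ∑' n : ℕ, e * C * (e * q) ^ n := by
        refine ENNReal.tsum_le_tsum fun n => ?_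
        calc ∫⁻ x, {x | n ≤ f x}.indicator (fun _ => e ^ (n + 1)) x ∂μ
            ≤ e ^ (n + 1) * (C * q ^ n) :=
              (lintegral_indicator_const_le _ _).trans (by gcongr; exact tail n)
          _ = e * C * (e * q) ^ n := by ring
    _ = e * C * (1 - e * q)⁻¹ := by rw [ENNReal.tsum_mul_left, ENNReal.tsum_geometric]
    _ < ∞ := ENNReal.mul_lt_top (by finiteness) (ENNReal.inv_lt_top.2 (tsub_pos_of_lt hq))

namespace IsConvexProbabilityMeasure

variable {X : Type*} [NormedAddCommGroup X] [NormedSpace ℝ X] [MeasurableSpace X] [BorelSpace X]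
  {μ : Measure X}

theorem measureReal_compl_smul_le (hμ : IsConvexProbabilityMeasure μ) {A : Set X}
    (hA : Convex ℝ A) (hA_neg : ∀ x ∈ A, -x ∈ A) (hA_meas : MeasurableSet A)
    (hA_pos : 0 < μ.real A) {t : ℝ} (ht : 1 ≤ t) :
    μ.real (t • A)ᶜ ≤ μ.real A * ((1 - μ.real A) / μ.real A) ^ ((t + 1) / 2) := by
  have := hμ.isProbability
  have hA_le : μ.real A ≤ 1 := measureReal_le_one
  rcases (t • A)ᶜ.eq_empty_or_nonempty with h_empty | h_nonempty
  · rw [h_empty, measureReal_empty]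
    exact mul_nonneg hA_pos.le (Real.rpow_nonneg (div_nonneg (by linarith) hA_pos.le) _)
  have convexity := (hμ.convex_ineq (2 / (t + 1)) (by positivity)
    ((div_le_one (by positivity)).2 (by linarith)) _ _ (hA_meas.const_smul₀ t).compl hA_meas
    h_nonempty (nonempty_of_measureReal_ne_zero hA_pos.ne')).trans
    (measure_mono (smul_compl_smul_add_smul_subset_compl hA hA_neg ht))
  rw [← inv_div 2]
  refine le_mul_div_rpow_inv_of_rpow_mul_rpow_le measureReal_nonneg hA_pos (by positivity) ?_
  rw [← probReal_compl_eq_one_sub hA_meas]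
  simpa only [measureReal_def, ENNReal.toReal_rpow, ENNReal.toReal_mul] using
    ENNReal.toReal_mono (measure_ne_top _ _) convexity

theorem measureReal_mul_le_norm_le (hμ : IsConvexProbabilityMeasure μ) {R : ℝ}
    (hR : 9 / 10 < μ.real (Metric.ball 0 R)) (n : ℕ) :
    μ.real {u | n * R ≤ ‖u‖} ≤ (1 / 3) ^ n := by
  have := hμ.isProbability
  rcases n.eq_zero_or_pos with rfl | hn
  · simp
  have hn₁ : (1 : ℝ) ≤ n := by exact_mod_cast hn
  set p := μ.real (Metric.ball 0 R)
  have hp₁ : p ≤ 1 := measureReal_le_one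
  have ratio_le : (1 - p) / p ≤ 1 / 9 := by rw [div_le_iff₀ (by linarith)]; linarith
  have setOf_eq : {u : X | n * R ≤ ‖u‖} = ((n : ℝ) • Metric.ball 0 R)ᶜ := by
    ext u
    simp [smul_ball (by positivity : (n : ℝ) ≠ 0)]
  calc μ.real {u | n * R ≤ ‖u‖}
      ≤ p * ((1 - p) / p) ^ (((n : ℝ) + 1) / 2) := by
        rw [setOf_eq]
        exact hμ.measureReal_compl_smul_le (convex_ball 0 R) (fun x hx => by simpa using hx)
          Metric.isOpen_ball.measurableSet (by linarith) hn₁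
    _ ≤ 1 * (1 / 9) ^ ((n : ℝ) / 2) := by
        gcongr ?_ * ?_
        calc ((1 - p) / p) ^ (((n : ℝ) + 1) / 2) ≤ (1 / 9) ^ (((n : ℝ) + 1) / 2) :=
              Real.rpow_le_rpow (div_nonneg (by linarith) (by linarith)) ratio_le (by positivity)
          _ ≤ (1 / 9) ^ ((n : ℝ) / 2) :=
              Real.rpow_le_rpow_of_exponent_ge (by norm_num) (by norm_num) (by linarith)
    _ = (1 / 3) ^ n := by
        rw [one_mul, show (1 / 9 : ℝ) = (1 / 3) ^ (2 : ℝ) by norm_num,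
          ← Real.rpow_mul (by norm_num), mul_div_cancel₀ _ two_ne_zero, Real.rpow_natCast]

theorem exists_hasExpMoment (hμ : IsConvexProbabilityMeasure μ) :
    ∃ κ : ℝ, 0 < κ ∧ HasExpMoment μ κ := by
  have := hμ.isProbability
  obtain ⟨R, hR, hR_ball⟩ := exists_lt_measureReal_ball μ 0 (c := 9 / 10) (by norm_num)
  refine ⟨Real.log 2 / R, by positivity, ?_⟩
  have integrable : Integrable (fun u : X => Real.exp (Real.log 2 * (‖u‖ / R))) μ := by
    refine integrable_exp_mul_of_measure_natCast_le_le (C := 1) (q := ENNReal.ofReal (1 / 3))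
      (by fun_prop) (fun u => by positivity) (by positivity) ENNReal.one_ne_top ?_ fun n => ?_
    · rw [Real.exp_log two_pos, ← ENNReal.ofReal_mul two_pos.le, ENNReal.ofReal_lt_one]
      norm_num
    · simp only [le_div_iff₀ hR]
      rw [one_mul, ← ENNReal.ofReal_pow (by norm_num), ← ofReal_measureReal]
      exact ENNReal.ofReal_le_ofReal (hμ.measureReal_mul_le_norm_le hR_ball n)
  simpa only [HasExpMoment, div_mul_eq_mul_div, mul_div_assoc] using integrable

end IsConvexProbabilityMeasure

end Borell

section Hellinger

theorem sq_sqrt_sub_sqrt_le {a b : ℝ} (ha : 0 ≤ a) (hb : 0 ≤ b) : (√a - √b) ^ 2 ≤ |a - b| := by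
  have abs_sub_le : |√a - √b| ≤ √a + √b :=
    abs_le.2 ⟨by linarith [a.sqrt_nonneg], by linarith [b.sqrt_nonneg]⟩
  calc (√a - √b) ^ 2 = |√a - √b| * |√a - √b| := by rw [← sq_abs, sq]
    _ ≤ |√a - √b| * (√a + √b) := by gcongr
    _ = |(√a - √b) * (√a + √b)| := by rw [abs_mul, abs_of_nonneg (a := √a + √b) (by positivity)]
    _ = |a - b| := by rw [mul_comm, ← sq_sub_sq, Real.sq_sqrt ha, Real.sq_sqrt hb]

theorem abs_exp_sub_exp_le {a b m : ℝ} (ha : a ≤ m) (hb : b ≤ m) :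
    |Real.exp a - Real.exp b| ≤ Real.exp m * |a - b| :=
  (convex_Iic m).norm_image_sub_le_of_norm_hasDerivWithin_le
    (fun x _ => (Real.hasDerivAt_exp x).hasDerivWithinAt)
    (fun x hx => by rw [Real.norm_of_nonneg (Real.exp_pos _).le]; exact Real.exp_le_exp.2 hx) hb ha

variable {X : Type*} [MeasurableSpace X] {μ ν₁ ν₂ : Measure X}

theorem hellingerDist_sq_eq [SigmaFinite μ] [IsFiniteMeasure ν₁] [IsFiniteMeasure ν₂]
    (h₁ : ν₁ ≪ μ) (h₂ : ν₂ ≪ μ) :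
    hellingerDist ν₁ ν₂ ^ 2 =
      1 / 2 * ∫ u, (√(ν₁.rnDeriv μ u).toReal - √(ν₂.rnDeriv μ u).toReal) ^ 2 ∂μ := by
  have chain₁ : ν₁.rnDeriv (ν₁ + ν₂) * (ν₁ + ν₂).rnDeriv μ =ᵐ[μ] ν₁.rnDeriv μ :=
    Measure.rnDeriv_mul_rnDeriv (Measure.AbsolutelyContinuous.rfl.add_right _)
  have chain₂ : ν₂.rnDeriv (ν₁ + ν₂) * (ν₁ + ν₂).rnDeriv μ =ᵐ[μ] ν₂.rnDeriv μ :=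
    Measure.rnDeriv_mul_rnDeriv (Measure.AbsolutelyContinuous.rfl.add_right' _)
  rw [hellingerDist, Real.sq_sqrt
    (mul_nonneg (by norm_num) (integral_nonneg fun u => sq_nonneg _)),
    ← integral_toReal_rnDeriv_mul (h₁.add_left h₂)]
  congr 1
  refine integral_congr_ae ?_
  filter_upwards [chain₁, chain₂] with u hu₁ hu₂
  rw [← hu₁, ← hu₂, Pi.mul_apply, Pi.mul_apply, ENNReal.toReal_mul, ENNReal.toReal_mul,
    Real.sqrt_mul ENNReal.toReal_nonneg, Real.sqrt_mul ENNReal.toReal_nonneg, ← sub_mul, mul_pow,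
    Real.sq_sqrt ENNReal.toReal_nonneg, mul_comm]

theorem hellingerDist_sq_le [SigmaFinite μ] [IsFiniteMeasure ν₁] [IsFiniteMeasure ν₂]
    (h₁ : ν₁ ≪ μ) (h₂ : ν₂ ≪ μ) :
    hellingerDist ν₁ ν₂ ^ 2 ≤
      1 / 2 * ∫ u, |(ν₁.rnDeriv μ u).toReal - (ν₂.rnDeriv μ u).toReal| ∂μ := by
  rw [hellingerDist_sq_eq h₁ h₂]
  have integrable : Integrable
      (fun u => (ν₁.rnDeriv μ u).toReal - (ν₂.rnDeriv μ u).toReal) μ :=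
    Measure.integrable_toReal_rnDeriv.sub Measure.integrable_toReal_rnDeriv
  exact mul_le_mul_of_nonneg_left (integral_mono_of_nonneg (ae_of_all _ fun u => sq_nonneg _)
    integrable.abs (ae_of_all _ fun u =>
      sq_sqrt_sub_sqrt_le ENNReal.toReal_nonneg ENNReal.toReal_nonneg)) (by norm_num)

theorem integral_abs_normalized_sub_le {f g : X → ℝ} (hf : Integrable f μ) (hg : Integrable g μ)
    (hg₀ : 0 ≤ g) (hf_pos : 0 < ∫ u, f u ∂μ) (hg_pos : 0 < ∫ u, g u ∂μ) :
    ∫ u, |(∫ v, f v ∂μ)⁻¹ * f u - (∫ v, g v ∂μ)⁻¹ * g u| ∂μ ≤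
      2 * ((∫ u, f u ∂μ)⁻¹ * ∫ u, |f u - g u| ∂μ) := by
  set a := ∫ u, f u ∂μ
  set b := ∫ u, g u ∂μ
  have abs_sub_le : |a - b| ≤ ∫ u, |f u - g u| ∂μ := by
    rw [← integral_sub hf hg]
    exact abs_integral_le_integral_abs
  have inv_sub_inv_mul : |a⁻¹ - b⁻¹| * b = a⁻¹ * |a - b| := by
    rw [inv_sub_inv hf_pos.ne' hg_pos.ne', abs_div, abs_mul, abs_of_pos hf_pos, abs_of_pos hg_pos,
      abs_sub_comm]
    field_simp
  have hfg : Integrable (fun u => |f u - g u|) μ := (hf.sub hg).abs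
  have pointwise (u : X) : |a⁻¹ * f u - b⁻¹ * g u| ≤ a⁻¹ * |f u - g u| + |a⁻¹ - b⁻¹| * g u := by
    calc |a⁻¹ * f u - b⁻¹ * g u| = |a⁻¹ * (f u - g u) + (a⁻¹ - b⁻¹) * g u| := by ring_nf
      _ ≤ |a⁻¹ * (f u - g u)| + |(a⁻¹ - b⁻¹) * g u| := abs_add_le _ _
      _ = a⁻¹ * |f u - g u| + |a⁻¹ - b⁻¹| * g u := by
          rw [abs_mul, abs_mul, abs_of_pos (inv_pos.2 hf_pos), abs_of_nonneg (hg₀ u)]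
  calc ∫ u, |a⁻¹ * f u - b⁻¹ * g u| ∂μ
      ≤ ∫ u, (a⁻¹ * |f u - g u| + |a⁻¹ - b⁻¹| * g u) ∂μ :=
        integral_mono ((hf.const_mul _).sub (hg.const_mul _)).abs
          ((hfg.const_mul _).add (hg.const_mul _)) pointwise
    _ = a⁻¹ * (∫ u, |f u - g u| ∂μ) + a⁻¹ * |a - b| := by
        rw [integral_add (hfg.const_mul _) (hg.const_mul _), integral_const_mul,
          integral_const_mul, inv_sub_inv_mul]
    _ ≤ a⁻¹ * (∫ u, |f u - g u| ∂μ) + a⁻¹ * ∫ u, |f u - g u| ∂μ := by gcongr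
    _ = 2 * (a⁻¹ * ∫ u, |f u - g u| ∂μ) := (two_mul _).symm

end Hellinger

section Moments

variable {X : Type*} [NormedAddCommGroup X] [MeasurableSpace X] {μ : Measure X}

theorem HasExpMoment.mono [OpensMeasurableSpace X] {κ α : ℝ} (h : HasExpMoment μ κ)
    (hα : α ≤ κ) : HasExpMoment μ α := by
  refine Integrable.mono' h (by fun_prop) (ae_of_all _ fun u => ?_)
  rw [Real.norm_of_nonneg (Real.exp_pos _).le]
  gcongr

theorem HasExpMoment.integrable_exp_neg {α M : ℝ} (h : HasExpMoment μ α) {φ : X → ℝ}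
    (hφ : AEMeasurable φ μ) (hM : ∀ u, M - α * ‖u‖ ≤ φ u) :
    Integrable (fun u => Real.exp (-φ u)) μ := by
  refine Integrable.mono' (h.const_mul (Real.exp (-M))) hφ.neg.exp.aestronglyMeasurable
    (ae_of_all _ fun u => ?_)
  rw [Real.norm_of_nonneg (Real.exp_pos _).le, ← Real.exp_add]
  gcongr
  linarith [hM u]

theorem HasExpMoment.integral_abs_exp_neg_sub_exp_neg_le {α β M C δ : ℝ}
    (h : HasExpMoment μ (α + β)) {φ ψ : X → ℝ} (hφ : ∀ u, M - α * ‖u‖ ≤ φ u)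
    (hψ : ∀ u, M - α * ‖u‖ ≤ ψ u) (hδ : ∀ u, |φ u - ψ u| ≤ Real.exp (β * ‖u‖ + C) * δ) :
    ∫ u, |Real.exp (-φ u) - Real.exp (-ψ u)| ∂μ ≤
      Real.exp (C - M) * (∫ u, Real.exp ((α + β) * ‖u‖) ∂μ) * δ := by
  rw [← integral_const_mul, ← integral_mul_const]
  refine integral_mono_of_nonneg (ae_of_all _ fun u => abs_nonneg _)
    ((h.const_mul _).mul_const _) (ae_of_all _ fun u => ?_)
  calc |Real.exp (-φ u) - Real.exp (-ψ u)|
      ≤ Real.exp (-(M - α * ‖u‖)) * |-φ u - -ψ u| :=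
        abs_exp_sub_exp_le (neg_le_neg (hφ u)) (neg_le_neg (hψ u))
    _ = Real.exp (-(M - α * ‖u‖)) * |φ u - ψ u| := by rw [neg_sub_neg, abs_sub_comm]
    _ ≤ Real.exp (-(M - α * ‖u‖)) * (Real.exp (β * ‖u‖ + C) * δ) := by gcongr; exact hδ u
    _ = Real.exp (C - M) * Real.exp ((α + β) * ‖u‖) * δ := by
        rw [← mul_assoc, ← Real.exp_add, ← Real.exp_add]; ring_nf

end Moments

section Posterior

variable {X Y Y' : Type*} [MeasurableSpace X] {μ ν ν' : Measure X} {Φ : X → Y → ℝ}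
  {Φ' : X → Y' → ℝ} {y : Y} {y' : Y'}

theorem IsPosterior.eq_withDensity [SigmaFinite μ] (h : IsPosterior μ Φ y ν) :
    ν = μ.withDensity fun u => ENNReal.ofReal ((normalizer μ Φ y)⁻¹ * Real.exp (-Φ u y)) := by
  have := h.isProbability
  rw [← withDensity_congr_ae h.bayes_rule,
    Measure.withDensity_rnDeriv_eq _ _ h.absolutelyContinuous]

theorem existsUnique_isPosterior [SigmaFinite μ] [NeZero μ]
    (hΦ : Integrable (fun u => Real.exp (-Φ u y)) μ) : ∃! ν, IsPosterior μ Φ y ν := by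
  have hZ : 0 < normalizer μ Φ y := integral_exp_pos hΦ
  refine ⟨μ.withDensity fun u => ENNReal.ofReal ((normalizer μ Φ y)⁻¹ * Real.exp (-Φ u y)),
    ⟨⟨?_⟩, withDensity_absolutelyContinuous _ _, hΦ, hZ, ?_⟩, fun ν hν => hν.eq_withDensity⟩
  · rw [withDensity_apply _ MeasurableSet.univ, Measure.restrict_univ,
      ← ofReal_integral_eq_lintegral_ofReal (hΦ.const_mul _) (ae_of_all _ fun u => by positivity),
      integral_const_mul, ← normalizer, inv_mul_cancel₀ hZ.ne', ENNReal.ofReal_one]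
  · exact Measure.rnDeriv_withDensity₀ μ (hΦ.const_mul _).aemeasurable.ennreal_ofReal

theorem exp_neg_mul_measureReal_le_normalizer [IsFiniteMeasure μ]
    (hΦ : Integrable (fun u => Real.exp (-Φ u y)) μ) {B : Set X} (hB : MeasurableSet B) {K : ℝ}
    (hK : ∀ u ∈ B, Φ u y ≤ K) : Real.exp (-K) * μ.real B ≤ normalizer μ Φ y :=
  calc Real.exp (-K) * μ.real B = ∫ _ in B, Real.exp (-K) ∂μ := by
        rw [setIntegral_const, smul_eq_mul, mul_comm]
    _ ≤ ∫ u in B, Real.exp (-Φ u y) ∂μ :=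
        setIntegral_mono_on (integrable_const _).integrableOn hΦ.integrableOn hB fun u hu =>
          Real.exp_le_exp.2 (neg_le_neg (hK u hu))
    _ ≤ normalizer μ Φ y := setIntegral_le_integral hΦ (ae_of_all _ fun u => (Real.exp_pos _).le)

theorem IsPosterior.hellingerDist_sq_le_inv_normalizer_mul [SigmaFinite μ]
    (hν : IsPosterior μ Φ y ν) (hν' : IsPosterior μ Φ' y' ν') :
    hellingerDist ν ν' ^ 2 ≤
      (normalizer μ Φ y)⁻¹ * ∫ u, |Real.exp (-Φ u y) - Real.exp (-Φ' u y')| ∂μ := by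
  have := hν.isProbability
  have := hν'.isProbability
  have hZ := hν.normalizer_pos
  have hZ' := hν'.normalizer_pos
  calc hellingerDist ν ν' ^ 2
      ≤ 1 / 2 * ∫ u, |(ν.rnDeriv μ u).toReal - (ν'.rnDeriv μ u).toReal| ∂μ :=
        hellingerDist_sq_le hν.absolutelyContinuous hν'.absolutelyContinuous
    _ = 1 / 2 * ∫ u, |(normalizer μ Φ y)⁻¹ * Real.exp (-Φ u y) -
          (normalizer μ Φ' y')⁻¹ * Real.exp (-Φ' u y')| ∂μ := by
        congr 1
        refine integral_congr_ae ?_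
        filter_upwards [hν.bayes_rule, hν'.bayes_rule] with u hu hu'
        rw [hu, hu', ENNReal.toReal_ofReal (by positivity), ENNReal.toReal_ofReal (by positivity)]
    _ ≤ 1 / 2 * (2 * ((normalizer μ Φ y)⁻¹ *
          ∫ u, |Real.exp (-Φ u y) - Real.exp (-Φ' u y')| ∂μ)) := by
        gcongr
        exact integral_abs_normalized_sub_le hν.integrable hν'.integrable
          (fun u => (Real.exp_pos _).le) hZ hZ'
    _ = (normalizer μ Φ y)⁻¹ * ∫ u, |Real.exp (-Φ u y) - Real.exp (-Φ' u y')| ∂μ := by ring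

end Posterior

section PosteriorOnNormedSpace

variable {X Y Y' : Type*} [NormedAddCommGroup X] [MeasurableSpace X] {μ ν ν' : Measure X}
  {Φ : X → Y → ℝ} {Φ' : X → Y' → ℝ} {y : Y} {y' : Y'}

theorem IsPosterior.hellingerDist_sq_le [IsFiniteMeasure μ] (hν : IsPosterior μ Φ y ν)
    (hν' : IsPosterior μ Φ' y' ν') {α β M K C δ : ℝ} {B : Set X} (hμ : HasExpMoment μ (α + β))
    (hM : ∀ u, M - α * ‖u‖ ≤ Φ u y) (hM' : ∀ u, M - α * ‖u‖ ≤ Φ' u y') (hB : MeasurableSet B)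
    (hB_pos : 0 < μ.real B) (hK : ∀ u ∈ B, Φ u y ≤ K)
    (hδ : ∀ u, |Φ u y - Φ' u y'| ≤ Real.exp (β * ‖u‖ + C) * δ) :
    hellingerDist ν ν' ^ 2 ≤ (Real.exp (-K) * μ.real B)⁻¹ *
      (Real.exp (C - M) * ∫ u, Real.exp ((α + β) * ‖u‖) ∂μ) * δ := by
  calc hellingerDist ν ν' ^ 2
      ≤ (normalizer μ Φ y)⁻¹ * ∫ u, |Real.exp (-Φ u y) - Real.exp (-Φ' u y')| ∂μ :=
        hν.hellingerDist_sq_le_inv_normalizer_mul hν'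
    _ ≤ (Real.exp (-K) * μ.real B)⁻¹ * ∫ u, |Real.exp (-Φ u y) - Real.exp (-Φ' u y')| ∂μ := by
        gcongr
        exact exp_neg_mul_measureReal_le_normalizer hν.integrable hB hK
    _ ≤ (Real.exp (-K) * μ.real B)⁻¹ *
          (Real.exp (C - M) * (∫ u, Real.exp ((α + β) * ‖u‖) ∂μ) * δ) := by
        gcongr
        exact hμ.integral_abs_exp_neg_sub_exp_neg_le hM hM' hδ
    _ = _ := (mul_assoc _ _ _).symm

theorem IsPosterior.isConvexProbabilityMeasure [NormedSpace ℝ X] [OpensMeasurableSpace X]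
    (hν : IsPosterior μ Φ y ν) (hμ : IsConvexProbabilityMeasure μ)
    (hΦ : Measurable fun u => Φ u y) (hΦ_conv : ConvexOn ℝ univ fun u => Φ u y) :
    IsConvexProbabilityMeasure ν := by
  have := hμ.isProbability
  have density_eq (u : X) : (normalizer μ Φ y)⁻¹ * Real.exp (-Φ u y) =
      Real.exp (-(Φ u y + Real.log (normalizer μ Φ y))) := by
    rw [neg_add_rev, Real.exp_add, Real.exp_neg (Real.log _), Real.exp_log hν.normalizer_pos]
  have ν_eq := hν.eq_withDensity
  simp only [density_eq] at ν_eq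
  rw [ν_eq]
  exact hμ.withDensity_exp_neg (hΦ.add_const _) (hΦ_conv.add_const _) (ν_eq ▸ hν.isProbability)

end PosteriorOnNormedSpace

namespace LikelihoodAssumption

variable {X Y : Type*} [NormedAddCommGroup X] [NormedAddCommGroup Y] {Φ : X → Y → ℝ}
  {α₁ α₂ : ℝ}

theorem locallyLipschitz (h : LikelihoodAssumption Φ α₁ α₂) (y : Y) :
    LocallyLipschitz fun u => Φ u y := by
  intro u
  obtain ⟨L, hL₀, hL⟩ := h.continuity_u (max ‖u‖ ‖y‖ + 1) (by positivity)
  refine ⟨⟨L, hL₀.le⟩, Metric.ball 0 (max ‖u‖ ‖y‖ + 1), Metric.isOpen_ball.mem_nhds ?_,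
    LipschitzOnWith.of_dist_le_mul fun v hv w hw => ?_⟩
  · simpa using (le_max_left ‖u‖ ‖y‖).trans_lt (lt_add_one _)
  · rw [Real.dist_eq, dist_eq_norm]
    exact hL v w y (max_lt (max_lt (by simpa using hv) (by simpa using hw))
      ((le_max_right _ _).trans_lt (lt_add_one _)))

variable [MeasurableSpace X] {μ : Measure X} {κ : ℝ}

theorem measurable [OpensMeasurableSpace X] (h : LikelihoodAssumption Φ α₁ α₂) (y : Y) :
    Measurable fun u => Φ u y :=
  (h.locallyLipschitz y).continuous.measurable

theorem integrable_exp_neg [OpensMeasurableSpace X] (h : LikelihoodAssumption Φ α₁ α₂)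
    (hμ : HasExpMoment μ α₁) (y : Y) : Integrable (fun u => Real.exp (-Φ u y)) μ := by
  obtain ⟨M, hM⟩ := h.lower_bound (‖y‖ + 1) (by positivity)
  exact hμ.integrable_exp_neg (h.measurable y).aemeasurable fun u => hM u y (lt_add_one _)

theorem exists_measurableSet_forall_le [OpensMeasurableSpace X] [IsFiniteMeasure μ] [NeZero μ]
    (h : LikelihoodAssumption Φ α₁ α₂) (r : ℝ) :
    ∃ B : Set X, MeasurableSet B ∧ 0 < μ.real B ∧
      ∃ K : ℝ, ∀ u ∈ B, ∀ y : Y, ‖y‖ < r → Φ u y ≤ K := by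
  obtain ⟨R, hR, hR_ball⟩ := exists_lt_measureReal_ball μ 0 measureReal_univ_pos
  obtain ⟨K, -, hK⟩ := h.bounded_above (max R r) (lt_max_of_lt_left hR)
  exact ⟨Metric.ball 0 R, Metric.isOpen_ball.measurableSet, hR_ball, K, fun u hu y hy =>
    hK u y (max_lt (lt_max_of_lt_left (by simpa using hu)) (lt_max_of_lt_right hy))⟩

theorem exists_hellingerDist_sq_le_mul_norm_sub [OpensMeasurableSpace X] [IsFiniteMeasure μ]
    [NeZero μ] (h : LikelihoodAssumption Φ α₁ α₂) (hμ : HasExpMoment μ (α₁ + α₂)) {r : ℝ}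
    (hr : 0 < r) :
    ∃ D : ℝ, 0 ≤ D ∧ ∀ y y' : Y, ‖y‖ < r → ‖y'‖ < r → ∀ ν ν' : Measure X,
      IsPosterior μ Φ y ν → IsPosterior μ Φ y' ν' → hellingerDist ν ν' ^ 2 ≤ D * ‖y - y'‖ := by
  obtain ⟨B, hB, hB_pos, K, hK⟩ := h.exists_measurableSet_forall_le (μ := μ) r
  obtain ⟨M, hM⟩ := h.lower_bound r hr
  obtain ⟨C, hC⟩ := h.continuity_y r hr
  refine ⟨(Real.exp (-K) * μ.real B)⁻¹ *
    (Real.exp (C - M) * ∫ u, Real.exp ((α₁ + α₂) * ‖u‖) ∂μ), ?_, fun y y' hy hy' ν ν' hν hν' =>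
    hν.hellingerDist_sq_le hν' hμ (fun u => hM u y hy) (fun u => hM u y' hy') hB hB_pos
      (fun u hu => hK u hu y hy) (hC y y' (max_lt hy hy'))⟩
  have : 0 ≤ ∫ u, Real.exp ((α₁ + α₂) * ‖u‖) ∂μ := integral_nonneg fun u => (Real.exp_pos _).le
  positivity

theorem isWellPosed [OpensMeasurableSpace X] [IsFiniteMeasure μ] [NeZero μ]
    (h : LikelihoodAssumption Φ α₁ α₂) (hα₂ : 0 ≤ α₂) (hμ : HasExpMoment μ (α₁ + α₂)) :
    IsWellPosed μ Φ := by
  refine ⟨fun y => existsUnique_isPosterior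
    (h.integrable_exp_neg (hμ.mono (le_add_of_nonneg_right hα₂)) y), fun r hr ε hε => ?_⟩
  obtain ⟨D, hD, hD_le⟩ := h.exists_hellingerDist_sq_le_mul_norm_sub hμ hr
  refine ⟨ε ^ 2 / (D + 1), by positivity, fun y y' hy hy' hyy' ν ν' hν hν' => ?_⟩
  refine lt_of_pow_lt_pow_left₀ 2 hε.le ?_
  calc hellingerDist ν ν' ^ 2 ≤ D * ‖y - y'‖ := hD_le y y' hy hy' ν ν' hν hν'
    _ ≤ ‖y - y'‖ * (D + 1) := by linarith [norm_nonneg (y - y')]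
    _ < ε ^ 2 := (lt_div_iff₀ (by positivity)).1 hyy'

theorem isConsistentApproximation [OpensMeasurableSpace X] [IsFiniteMeasure μ] [NeZero μ]
    {ΦN : ℕ → X → Y → ℝ} {y : Y} {α₃ : ℝ} (h : LikelihoodAssumption Φ α₁ α₂)
    (hN : ApproximationAssumption μ Φ ΦN y α₁ α₃) (hα₃ : 0 ≤ α₃)
    (hμ : HasExpMoment μ (α₁ + α₃)) : IsConsistentApproximation μ Φ ΦN y := by
  have hr : 0 < ‖y‖ + 1 := by positivity
  have hy : ‖y‖ < ‖y‖ + 1 := lt_add_one _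
  have hμ₁ : HasExpMoment μ α₁ := hμ.mono (le_add_of_nonneg_right hα₃)
  obtain ⟨M, hM⟩ := h.lower_bound _ hr
  obtain ⟨M', hM'⟩ := hN.lower_bound _ hr
  refine ⟨existsUnique_isPosterior (h.integrable_exp_neg hμ₁ y), fun N => existsUnique_isPosterior
    (hμ₁.integrable_exp_neg (hN.aemeasurable N) fun u => hM' N u y hy), fun ν νN hν hνN => ?_⟩
  obtain ⟨B, hB, hB_pos, K, hK⟩ := h.exists_measurableSet_forall_le (μ := μ) (‖y‖ + 1)
  obtain ⟨C, ψ, hψ, hC⟩ := hN.approx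
  have dist_sq_le (N : ℕ) := hν.hellingerDist_sq_le (hνN N) hμ
    (fun u => (sub_le_sub_right (min_le_left M M') _).trans (hM u y hy))
    (fun u => (sub_le_sub_right (min_le_right M M') _).trans (hM' N u y hy)) hB hB_pos
    (fun u hu => hK u hu y hy) (hC N)
  have dist_sq_tendsto : Tendsto (fun N => hellingerDist ν (νN N) ^ 2) atTop (𝓝 0) :=
    squeeze_zero (fun N => sq_nonneg _) dist_sq_le (by simpa using hψ.const_mul _)
  have dist_nonneg (N : ℕ) : 0 ≤ hellingerDist ν (νN N) := Real.sqrt_nonneg _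
  simpa [Real.sqrt_sq (dist_nonneg _)] using dist_sq_tendsto.sqrt

end LikelihoodAssumption

end BayesInverse

theorem mainTheorem1_general {X Y : Type*}
    [NormedAddCommGroup X] [NormedSpace ℝ X] [MeasurableSpace X] [BorelSpace X]
    [NormedAddCommGroup Y]
    (μ₀ : Measure X) (hμ₀ : BayesInverse.IsConvexProbabilityMeasure μ₀)
    (Φ : X → Y → ℝ) (α₁ α₂ : ℝ) (hα₂ : 0 ≤ α₂)
    (hΦ : BayesInverse.LikelihoodAssumption Φ α₁ α₂) :
    (∃ κ : ℝ, 0 < κ ∧ BayesInverse.HasExpMoment μ₀ κ) ∧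
    (BayesInverse.HasExpMoment μ₀ (α₁ + α₂) → BayesInverse.IsWellPosed μ₀ Φ) ∧
    (∀ (y : Y) (ΦN : ℕ → X → Y → ℝ) (α₃ : ℝ), 0 ≤ α₃ →
      BayesInverse.ApproximationAssumption μ₀ Φ ΦN y α₁ α₃ →
      BayesInverse.HasExpMoment μ₀ (α₁ + α₃) →
      BayesInverse.IsConsistentApproximation μ₀ Φ ΦN y) ∧
    (∀ y : Y, ConvexOn ℝ Set.univ (fun u => Φ u y) →
      ∀ ν : Measure X, BayesInverse.IsPosterior μ₀ Φ y ν →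
        BayesInverse.IsConvexProbabilityMeasure ν) := by
  have := hμ₀.isProbability
  exact ⟨hμ₀.exists_hasExpMoment, hΦ.isWellPosed hα₂,
    fun y ΦN α₃ hα₃ hN => hΦ.isConsistentApproximation hN hα₃,
    fun y hΦ_conv ν hν => hν.isConvexProbabilityMeasure hμ₀ (hΦ.measurable y) hΦ_conv⟩

theorem mainTheorem1 {X Y : Type*}
    [NormedAddCommGroup X] [NormedSpace ℝ X] [CompleteSpace X]
    [MeasurableSpace X] [BorelSpace X]
    [NormedAddCommGroup Y] [NormedSpace ℝ Y] [CompleteSpace Y]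
    (μ₀ : Measure X) (hμ₀ : BayesInverse.IsConvexProbabilityMeasure μ₀)
    (Φ : X → Y → ℝ) (α₁ α₂ : ℝ) (hα₁ : 0 ≤ α₁) (hα₂ : 0 ≤ α₂)
    (hΦ : BayesInverse.LikelihoodAssumption Φ α₁ α₂) :
    (∃ κ : ℝ, 0 < κ ∧ BayesInverse.HasExpMoment μ₀ κ) ∧
    ∀ κ : ℝ, 0 < κ → BayesInverse.HasExpMoment μ₀ κ → α₁ + 2 * α₂ ≤ κ →
      BayesInverse.IsWellPosed μ₀ Φ ∧
      (∀ (y : Y) (ΦN : ℕ → X → Y → ℝ) (α₃ : ℝ), 0 ≤ α₃ →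
        BayesInverse.ApproximationAssumption μ₀ Φ ΦN y α₁ α₃ → α₁ + 2 * α₃ ≤ κ →
        BayesInverse.IsConsistentApproximation μ₀ Φ ΦN y) ∧
      (∀ y : Y, ConvexOn ℝ Set.univ (fun u => Φ u y) →
        ∀ ν : Measure X, BayesInverse.IsPosterior μ₀ Φ y ν →
          BayesInverse.IsConvexProbabilityMeasure ν) := by
  exact (mainTheorem1_general μ₀ hμ₀ Φ α₁ α₂ hα₂ hΦ).imp_right
    fun ⟨wellPosed, consistent, convex⟩ κ _ hκ hα => ⟨wellPosed (hκ.mono (by linarith)),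
      fun y ΦN α₃ hα₃ hN hα' => consistent y ΦN α₃ hα₃ hN (hκ.mono (by linarith)), convex⟩
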